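/- Let $k\ge 1$. A perfect matching of the complete graph $K_{2k}$ is a set of pairwise vertex-disjoint edges covering all $2k$ vertices. Call a family of perfect matchings of $K_{2k}$ intersecting if any two of its members have an edge in common, and for an edge $e$ of $K_{2k}$ let $S_e$ be the family of all perfect matchings of $K_{2k}$ that contain $e$. Write $(2k-3)!!=(2k-3)(2k-5)\cdots 1$, with $(-1)!!=1$. Then every intersecting family $\mathcal F$ of perfect matchings of $K_{2k}$ satisfies $|\mathcal F|\le (2k-3)!!$, and a family $\mathcal F$ is intersecting with $|\mathcal F|=(2k-3)!!$ if and only if $\mathcal F=S_e$ for some edge $e$ of $K_{2k}$. Equivalently, let $M(2k)$ be the perfect matching derangement graph, whose vertices are the perfect matchings of $K_{2k}$, two of them being adjacent if and only if they have no edge in common, and call a set of pairwise non-adjacent vertices a coclique. Then the maximum size of a coclique of $M(2k)$ is $(2k-3)!!$, and the cocliques of maximum size are exactly the families $S_e$, where $e$ is an edge of $K_{2k}$. -/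

import Mathlib

open scoped Nat

namespace MatchingEKR

/-- The perfect matchings of the complete graph `K_{2k}` on the vertex set `Fin (2 * k)`. -/
abbrev PM (k : ℕ) : Type :=
  {M : (⊤ : SimpleGraph (Fin (2 * k))).Subgraph // M.IsPerfectMatching}

/-- Two perfect matchings intersect if they contain a common edge. -/
def Intersect {k : ℕ} (M N : PM k) : Prop :=
  ∃ e, e ∈ M.1.edgeSet ∧ e ∈ N.1.edgeSet

/-- A family of perfect matchings is intersecting if any two of its members share an edge. -/
def IsIntersecting {k : ℕ} (F : Set (PM k)) : Prop :=
  F.Pairwise Intersect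

/-- `S_e`: all perfect matchings that contain the edge `e`. -/
def canonical {k : ℕ} (e : Sym2 (Fin (2 * k))) : Set (PM k) :=
  {M | e ∈ M.1.edgeSet}

/-- The perfect matching derangement graph `M(2k)`: its vertices are the perfect matchings of
`K_{2k}`, and two of them are adjacent iff they have no edge in common. The clause `M ≠ N` is
automatic for `1 ≤ k`; it only rules out a loop at the empty matching when `k = 0`. -/
def derangementGraph (k : ℕ) : SimpleGraph (PM k) where
  Adj M N := M ≠ N ∧ ¬ Intersect M N
  symm := ⟨fun _ _ h => ⟨h.1.symm, fun ⟨e, h₁, h₂⟩ => h.2 ⟨e, h₂, h₁⟩⟩⟩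
  loopless := ⟨fun _ h => h.1 rfl⟩

end MatchingEKR

/-! Perfect matchings are treated as fixed-point-free involutions. Call a set of edges a cover of
$\mathcal F$ if every member of $\mathcal F$ contains one of them, and let $s$ be the least size of
a cover. Each member is itself a cover, so $s\le k$; if $s\le 1$, a nonempty $\mathcal F$ lies in
some $S_e$.

Let $s\ge 2$. A set $T$ of fewer than $s$ edges is disjoint from some $g\in\mathcal F$, and every
member containing $T$ meets $g$ in an edge off the vertices of $T$. This leaves at most $k-|T|$ ways
to extend $T$, and only $k-2$ if $|T|=1$, since $g$ has distinct edges at the two ends of the edge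
in $T$. Extending up to size $s$, where at most $(2(k-s)-1)!!$ matchings remain, bounds the members
through one edge (`card_link_singleton_le`). Summing over a minimum cover gives $|\mathcal F|\le
s(k-2)\cdot(k-2)(k-3)\cdots(k-s+1)\cdot(2(k-s)-1)!!$, which is below $(2k-3)!!$ when $s<k$. When
$s=k$ this can fail for small $k$, and summing over the edges of a member $f$, with $f$ counted only
once, suffices. -/

namespace MatchingEKR

open Finset Equiv

/-! ### Pairings and the number extending a partial matching -/

section Pairings

variable {α : Type*} [DecidableEq α]

/-- A pairing is a fixed-point-free involution; its orbits form a perfect matching. -/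
def IsPairing (f : Perm α) : Prop :=
  ∀ x, f x ≠ x ∧ f (f x) = x

theorem IsPairing.two_mul_card_image {f : Perm α} (hf : IsPairing f) {S : Finset α}
    (hS : ∀ x ∈ S, f x ∈ S) : 2 * #(S.image fun x => s(x, f x)) = #S := by
  rw [card_eq_sum_card_image (fun x => s(x, f x)) S, mul_comm, ← smul_eq_mul, ← sum_const]
  refine sum_congr rfl fun e he => ?_
  obtain ⟨y, hy, rfl⟩ := mem_image.1 he
  have : {x ∈ S | s(x, f x) = s(y, f y)} = {y, f y} := by
    ext x
    simp only [mem_filter, Sym2.eq_iff, mem_insert, mem_singleton]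
    constructor
    · rintro ⟨-, h | h⟩
      · exact Or.inl h.1
      · exact Or.inr h.1
    · rintro (rfl | rfl)
      · exact ⟨hy, Or.inl ⟨rfl, rfl⟩⟩
      · exact ⟨hS _ hy, Or.inr ⟨rfl, (hf y).2⟩⟩
  rw [this, card_pair (hf y).1.symm]

/-- The partner of `a` in a pairing `f` can be changed to any `b ≠ a`, affecting only the edges of
`f` at `a` and `b`. -/
theorem IsPairing.exists_apply_eq {f : Perm α} (hf : IsPairing f) {a b : α} (hba : b ≠ a) :
    ∃ h : Perm α, IsPairing h ∧ h a = b ∧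
      ∀ x, x ≠ b → x ≠ f a → f x ≠ b → f x ≠ f a → h x = f x := by
  -- Conjugating by a swap that fixes `a` renames its partner `f a` to `b`.
  set σ : Perm α := swap b (f a)
  have hσσ : ∀ x, σ (σ x) = x := fun x => swap_apply_self b (f a) x
  have hσa : σ a = a := swap_apply_of_ne_of_ne hba.symm (hf a).1.symm
  refine ⟨σ * f * σ, fun x => ?_, ?_, fun x h1 h2 h3 h4 => ?_⟩
  · simp only [Perm.mul_apply, hσσ, (hf _).2, and_true]
    intro hx
    apply (hf (σ x)).1
    rw [← hσσ (f (σ x)), hx]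
  · simp only [Perm.mul_apply, hσa]
    exact swap_apply_right b (f a)
  · have hσ : ∀ y, y ≠ b → y ≠ f a → σ y = y := fun y => swap_apply_of_ne_of_ne
    simp only [Perm.mul_apply, hσ x h1 h2, hσ _ h3 h4]

variable [Fintype α]

instance : DecidablePred (IsPairing (α := α)) := fun f => by
  unfold IsPairing; infer_instance

/-- The set of edges of a pairing. -/
def pairs (f : Perm α) : Finset (Sym2 α) :=
  univ.image fun x => s(x, f x)

theorem IsPairing.mem_pairs {f : Perm α} (hf : IsPairing f) {x y : α} :
    s(x, y) ∈ pairs f ↔ f x = y := by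
  simp only [pairs, mem_image, mem_univ, true_and, Sym2.eq_iff]
  constructor
  · rintro ⟨a, ⟨rfl, h⟩ | ⟨rfl, h⟩⟩
    · exact h
    · rw [← h, (hf a).2]
  · rintro rfl
    exact ⟨x, Or.inl ⟨rfl, rfl⟩⟩

theorem IsPairing.two_mul_card_pairs {f : Perm α} (hf : IsPairing f) :
    2 * #(pairs f) = Fintype.card α :=
  hf.two_mul_card_image fun _ _ => mem_univ _

/-- The number of pairings that agree with `f` on an `f`-invariant set with `2 * m` points in its
complement. -/
theorem IsPairing.card_agree {f : Perm α} (hf : IsPairing f) {m : ℕ} {S : Finset α}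
    (hS : ∀ x ∈ S, f x ∈ S) (hm : #Sᶜ = 2 * m) :
    #{g : Perm α | IsPairing g ∧ ∀ x ∈ S, g x = f x} = (2 * m - 1)‼ := by
  induction m generalizing f S with
  | zero =>
    have hS' : S = univ := by simpa using hm
    subst hS'
    rw [card_eq_one.2 ⟨f, ?_⟩]
    · rfl
    ext g
    simp only [mem_filter, mem_univ, true_and, mem_singleton, true_imp_iff]
    exact ⟨fun h => Equiv.ext h.2, fun h => by subst h; exact ⟨hf, fun _ => rfl⟩⟩
  | succ m ih =>
    obtain ⟨a, ha⟩ : Sᶜ.Nonempty := card_pos.1 (by omega)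
    have haS : a ∉ S := by simpa using ha
    have hfa : f a ∉ S := fun h => haS (by simpa [(hf a).2] using hS _ h)
    -- Sort by the partner `b` of `a`; each fibre is again an agreement set, for a pairing `h` with
    -- `h a = b` and the set `S ∪ {a, b}`.
    rw [card_eq_sum_card_fiberwise (f := fun g => g a) (t := Sᶜ.erase a)]
    · rw [sum_const_nat (m := (2 * m - 1)‼), card_erase_of_mem ha, hm]
      -- For `m = 0` the index `2 * m - 1` truncates to `0`, and `0‼ = 1` plays the role of `(-1)‼`.
      · cases m with
        | zero => rfl
        | succ n => rfl
      intro b hb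
      obtain ⟨hba, hb⟩ := mem_erase.1 hb
      have hbS : b ∉ S := by simpa using hb
      obtain ⟨h, hhp, hha, hhf⟩ := hf.exists_apply_eq hba
      have hhb : h b = a := by rw [← hha, (hhp a).2]
      have hhS : ∀ x ∈ S, h x = f x := fun x hx =>
        hhf x (ne_of_mem_of_not_mem hx hbS) (ne_of_mem_of_not_mem hx hfa)
          (ne_of_mem_of_not_mem (hS x hx) hbS) (ne_of_mem_of_not_mem (hS x hx) hfa)
      have hS' : ∀ x ∈ insert a (insert b S), h x ∈ insert a (insert b S) := by
        intro x hx
        simp only [mem_insert] at hx ⊢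
        rcases hx with rfl | rfl | hx
        · exact Or.inr (Or.inl hha)
        · exact Or.inl hhb
        · exact Or.inr (Or.inr (by rw [hhS x hx]; exact hS x hx))
      rw [← ih hhp hS']
      · congr 1
        ext g
        simp only [mem_filter, mem_univ, true_and, mem_insert, forall_eq_or_imp, hha, hhb]
        constructor
        · rintro ⟨⟨h1, h2⟩, rfl⟩
          exact ⟨h1, rfl, (h1 a).2, fun x hx => by rw [h2 x hx, hhS x hx]⟩
        · rintro ⟨h1, h2, -, h4⟩
          exact ⟨⟨h1, fun x hx => by rw [h4 x hx, hhS x hx]⟩, h2⟩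
      · have h1 := card_compl_add_card S
        have h2 := card_compl_add_card (insert a (insert b S))
        rw [card_insert_of_notMem (by simp [haS, hba.symm]), card_insert_of_notMem hbS] at h2
        omega
    · intro g hg
      simp only [coe_filter, Set.mem_ofPred_eq, mem_univ, true_and] at hg
      simp only [coe_erase, coe_compl, Set.mem_sdiff, Set.mem_compl_iff, mem_coe,
        Set.mem_singleton_iff]
      refine ⟨fun h => haS ?_, (hg.1 a).1⟩
      have h1 := hg.2 _ h
      rw [(hg.1 a).2] at h1
      rw [h1]
      exact hS _ h

/-- The vertices covered by the edges of `T`, where `T` is a set of edges of the pairing `f`. -/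
def coveredBy (f : Perm α) (T : Finset (Sym2 α)) : Finset α :=
  {x | s(x, f x) ∈ T}

theorem mem_coveredBy {f : Perm α} {T : Finset (Sym2 α)} {x : α} :
    x ∈ coveredBy f T ↔ s(x, f x) ∈ T := by
  simp [coveredBy]

theorem IsPairing.apply_mem_coveredBy {f : Perm α} (hf : IsPairing f) {T : Finset (Sym2 α)}
    {x : α} (hx : x ∈ coveredBy f T) : f x ∈ coveredBy f T := by
  rw [mem_coveredBy] at hx ⊢
  rwa [(hf x).2, Sym2.eq_swap]

theorem image_coveredBy {f : Perm α} {T : Finset (Sym2 α)}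
    (hT : T ⊆ pairs f) : (coveredBy f T).image (fun x => s(x, f x)) = T := by
  ext e
  simp only [mem_image, mem_coveredBy]
  constructor
  · rintro ⟨x, hx, rfl⟩
    exact hx
  · intro he
    obtain ⟨x, -, rfl⟩ := mem_image.1 (hT he)
    exact ⟨x, he, rfl⟩

theorem IsPairing.card_coveredBy {f : Perm α} (hf : IsPairing f) {T : Finset (Sym2 α)}
    (hT : T ⊆ pairs f) : #(coveredBy f T) = 2 * #T := by
  rw [← hf.two_mul_card_image fun _ => hf.apply_mem_coveredBy, image_coveredBy hT]

theorem IsPairing.subset_pairs_iff {f g : Perm α} (hg : IsPairing g)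
    {T : Finset (Sym2 α)} (hT : T ⊆ pairs f) :
    T ⊆ pairs g ↔ ∀ x ∈ coveredBy f T, g x = f x := by
  constructor
  · intro h x hx
    exact hg.mem_pairs.1 (h (mem_coveredBy.1 hx))
  · intro h e he
    obtain ⟨x, -, rfl⟩ := mem_image.1 (hT he)
    exact hg.mem_pairs.2 (h x (mem_coveredBy.2 he))

/-- The number of pairings of `2 * k` points that contain a given partial matching. -/
theorem IsPairing.card_superset {f : Perm α} (hf : IsPairing f) {k : ℕ}
    (hk : Fintype.card α = 2 * k) {T : Finset (Sym2 α)} (hT : T ⊆ pairs f) :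
    #{g : Perm α | IsPairing g ∧ T ⊆ pairs g} = (2 * (k - #T) - 1)‼ := by
  rw [← hf.card_agree (S := coveredBy f T) fun _ => hf.apply_mem_coveredBy]
  · congr 1
    ext g
    simp only [mem_filter, mem_univ, true_and]
    exact and_congr_right fun hg => hg.subset_pairs_iff hT
  · rw [card_compl, hf.card_coveredBy hT]
    omega

/-! ### Links and covers -/

/-- The members of `F` that contain all edges of `T`. -/
def link (F : Finset (Perm α)) (T : Finset (Sym2 α)) : Finset (Perm α) :=
  {f ∈ F | T ⊆ pairs f}

theorem mem_link {F : Finset (Perm α)} {T : Finset (Sym2 α)} {f : Perm α} :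
    f ∈ link F T ↔ f ∈ F ∧ T ⊆ pairs f := by
  simp [link]

theorem card_link_le {F : Finset (Perm α)} (hF : ∀ f ∈ F, IsPairing f) {k : ℕ}
    (hk : Fintype.card α = 2 * k) (T : Finset (Sym2 α)) :
    #(link F T) ≤ (2 * (k - #T) - 1)‼ := by
  rcases (link F T).eq_empty_or_nonempty with h | ⟨f, hf⟩
  · simp [h]
  · rw [mem_link] at hf
    rw [← (hF f hf.1).card_superset hk hf.2]
    refine card_le_card fun g hg => ?_
    rw [mem_link] at hg
    simpa using ⟨hF g hg.1, hg.2⟩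

/-- If every member of `F` meets `g`, then the members containing `T` are distributed among the
edges of `g` that avoid the vertices covered by `T`. -/
theorem card_link_le_of_disjoint {F : Finset (Perm α)} (hF : ∀ f ∈ F, IsPairing f)
    {T : Finset (Sym2 α)} {f g : Perm α} (hf : f ∈ F) (hT : T ⊆ pairs f) (hg : IsPairing g)
    (hgF : ∀ h ∈ F, (pairs h ∩ pairs g).Nonempty) (hTg : Disjoint T (pairs g)) {b : ℕ}
    (hb : ∀ e ∉ T, #(link F (insert e T)) ≤ b) {d : ℕ}
    (hd : #{x | x ∉ coveredBy f T ∧ g x ∉ coveredBy f T} ≤ 2 * d) :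
    #(link F T) ≤ d * b := by
  set U : Finset α := {x | x ∉ coveredBy f T ∧ g x ∉ coveredBy f T} with hU
  have hUg : ∀ x ∈ U, g x ∈ U := by
    intro x hx
    simp only [hU, mem_filter, mem_univ, true_and, (hg x).2] at hx ⊢
    exact hx.symm
  have hcard := hg.two_mul_card_image hUg
  set D := U.image fun x => s(x, g x) with hD
  have hDg : D ⊆ pairs g := image_subset_image (subset_univ _)
  have hsub : link F T ⊆ D.biUnion fun e => link F (insert e T) := by
    intro h hh
    rw [mem_link] at hh
    obtain ⟨e, he⟩ := hgF h hh.1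
    rw [mem_inter] at he
    rw [mem_biUnion]
    refine ⟨e, ?_, mem_link.2 ⟨hh.1, insert_subset he.1 hh.2⟩⟩
    -- The common edge of `h` and `g` is not in `T`; as `h` contains `T`, neither end of it can be
    -- covered by `T`.
    have heT : e ∉ T := fun h' => disjoint_left.1 hTg h' he.2
    obtain ⟨x, -, rfl⟩ := mem_image.1 he.2
    refine mem_image.2 ⟨x, ?_, rfl⟩
    have hhp := hF h hh.1
    have hhx : h x = g x := hhp.mem_pairs.1 he.1
    have hagree := (hhp.subset_pairs_iff hT).1 hh.2
    have hx : x ∉ coveredBy f T := fun hx => heT (by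
      rw [← hhx, hagree x hx]; exact mem_coveredBy.1 hx)
    have hgx : g x ∉ coveredBy f T := fun hx' => hx (by
      have h1 := (hF f hf).apply_mem_coveredBy hx'
      rwa [← hagree _ hx', ← hhx, (hhp x).2] at h1)
    simp [hU, hx, hgx]
  calc #(link F T) ≤ ∑ e ∈ D, #(link F (insert e T)) :=
        (card_le_card hsub).trans card_biUnion_le
    _ ≤ ∑ _e ∈ D, b := sum_le_sum fun e he =>
        hb e fun h => disjoint_left.1 hTg h (hDg he)
    _ = #D * b := by rw [sum_const, smul_eq_mul]
    _ ≤ d * b := Nat.mul_le_mul_right _ (by omega)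

/-- `C` covers `F` if every member of `F` contains an edge from `C`. -/
def Covers (C : Finset (Sym2 α)) (F : Finset (Perm α)) : Prop :=
  ∀ f ∈ F, ¬ Disjoint C (pairs f)

/-- While `T` has fewer than `s` edges it is no cover, so some member avoids it and offers at most
`k - #T` edges for extension. The product of these choices is the falling factorial; at size `s` the
count of all pairings containing `T` takes over. -/
theorem card_link_le_descFactorial {F : Finset (Perm α)} (hF : ∀ f ∈ F, IsPairing f)
    (hint : ∀ f ∈ F, ∀ g ∈ F, (pairs f ∩ pairs g).Nonempty) {k : ℕ}
    (hk : Fintype.card α = 2 * k) {s : ℕ}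
    (hs : ∀ C : Finset (Sym2 α), #C < s → ¬ Covers C F) (j : ℕ) (T : Finset (Sym2 α))
    (hT : #T + j = s) :
    #(link F T) ≤ (k - #T).descFactorial j * (2 * (k - s) - 1)‼ := by
  induction j generalizing T with
  | zero =>
    rw [add_zero] at hT
    subst hT
    simpa using card_link_le hF hk T
  | succ j ih =>
    rcases (link F T).eq_empty_or_nonempty with h | ⟨f, hf⟩
    · simp [h]
    rw [mem_link] at hf
    have hTc := hs T (by omega)
    simp only [Covers, not_forall, not_not] at hTc
    obtain ⟨g, hgF, hTg⟩ := hTc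
    have hfT := (hF f hf.1).card_coveredBy hf.2
    have hle : 2 * #T ≤ 2 * k := by rw [← hfT, ← hk]; exact card_le_univ _
    have key := card_link_le_of_disjoint hF hf.1 hf.2 (hF g hgF) (fun h hh => hint h hh g hgF) hTg
      (b := (k - #T - 1).descFactorial j * (2 * (k - s) - 1)‼) (d := k - #T)
      (fun e he => by
        have := ih (insert e T) (by rw [card_insert_of_notMem he]; omega)
        rwa [card_insert_of_notMem he, ← Nat.sub_sub] at this)
      (by
        refine (card_le_card (t := (coveredBy f T)ᶜ) fun x hx => ?_).trans ?_
        · simp only [mem_filter, mem_univ, true_and] at hx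
          simpa using hx.1
        · rw [card_compl, hfT, hk]; omega)
    refine key.trans ?_
    rw [← mul_assoc]
    apply Nat.mul_le_mul_right
    rcases hkT : k - #T with _ | n
    · simp
    · rw [Nat.succ_descFactorial_succ]; simp

/-- The first extension has `k - 2` choices rather than `k - 1`: the member `g` avoiding `e` has two
different edges at the ends of `e`, both unusable. This saving is what makes the final bound strict.
-/
theorem card_link_singleton_le {F : Finset (Perm α)} (hF : ∀ f ∈ F, IsPairing f)
    (hint : ∀ f ∈ F, ∀ g ∈ F, (pairs f ∩ pairs g).Nonempty) {k : ℕ}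
    (hk : Fintype.card α = 2 * k) {s : ℕ} (hs2 : 2 ≤ s)
    (hs : ∀ C : Finset (Sym2 α), #C < s → ¬ Covers C F) (e : Sym2 α) :
    #(link F {e}) ≤ (k - 2) * ((k - 2).descFactorial (s - 2) * (2 * (k - s) - 1)‼) := by
  rcases (link F {e}).eq_empty_or_nonempty with h | ⟨f, hf⟩
  · simp [h]
  rw [mem_link] at hf
  have hTc := hs {e} (by rw [card_singleton]; omega)
  simp only [Covers, not_forall, not_not] at hTc
  obtain ⟨g, hgF, hTg⟩ := hTc
  have hfp := hF f hf.1
  have hgp := hF g hgF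
  refine card_link_le_of_disjoint hF hf.1 hf.2 hgp (fun h hh => hint h hh g hgF) hTg
    (fun e' he' => ?_) ?_
  · have hc : #(insert e' {e}) = 2 := by rw [card_insert_of_notMem he', card_singleton]
    have := card_link_le_descFactorial hF hint hk hs (s - 2) (insert e' {e}) (by omega)
    rwa [hc] at this
  · obtain ⟨a, -, rfl⟩ := mem_image.1 (hf.2 (mem_singleton_self _))
    have hga : g a ≠ f a := fun h =>
      disjoint_left.1 hTg (mem_singleton_self _) (hgp.mem_pairs.2 h)
    have h1 : a ∈ coveredBy f {s(a, f a)} := by simp [mem_coveredBy]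
    have h2 := hfp.apply_mem_coveredBy h1
    have hsub : ({x | x ∉ coveredBy f {s(a, f a)} ∧ g x ∉ coveredBy f {s(a, f a)}} : Finset α) ⊆
        ({a, f a, g a, g (f a)} : Finset α)ᶜ := by
      intro x hx
      simp only [mem_filter, mem_univ, true_and] at hx
      simp only [mem_compl, mem_insert, mem_singleton, not_or]
      refine ⟨fun h => hx.1 (h ▸ h1), fun h => hx.1 (h ▸ h2), fun h => hx.2 ?_, fun h => hx.2 ?_⟩
      · rw [h, (hgp a).2]; exact h1
      · rw [h, (hgp (f a)).2]; exact h2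
    refine (card_le_card hsub).trans ?_
    have h4 : #({a, f a, g a, g (f a)} : Finset α) = 4 := by
      rw [card_insert_of_notMem, card_insert_of_notMem, card_insert_of_notMem, card_singleton]
      · simpa using (hfp a).1.symm
      · simp only [mem_insert, mem_singleton, not_or]
        exact ⟨hga.symm, (hgp (f a)).1.symm⟩
      · simp only [mem_insert, mem_singleton, not_or]
        refine ⟨(hfp a).1.symm, (hgp a).1.symm, fun h => hga ?_⟩
        rw [h, (hgp (f a)).2, ← h]
    rw [card_compl, h4, hk]
    omega

end Pairings

/-! ### Numerical inequalities -/

/-- For `s = 2` this is `2 * (k - 2) < 2 * k - 3`, and the left side does not grow as `s` increases.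
-/
theorem mul_descFactorial_mul_doubleFactorial_lt {k s : ℕ} (hs : 2 ≤ s) (hsk : s < k) :
    s * ((k - 2) * ((k - 2).descFactorial (s - 2) * (2 * (k - s) - 1)‼)) < (2 * k - 3)‼ := by
  induction s, hs using Nat.le_induction with
  | base =>
    obtain ⟨r, rfl⟩ := Nat.exists_eq_add_of_lt hsk
    have h1 : 2 * (2 + r + 1) - 3 = 2 * r + 1 + 2 := by omega
    have h2 : 2 * (2 + r + 1 - 2) - 1 = 2 * r + 1 := by omega
    have h3 : 2 + r + 1 - 2 = r + 1 := by omega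
    rw [h1, h2, h3, Nat.doubleFactorial]
    have := Nat.doubleFactorial_pos (2 * r + 1)
    simp only [Nat.sub_self, Nat.descFactorial_zero, one_mul, ← mul_assoc]
    exact Nat.mul_lt_mul_of_pos_right (by omega) this
  | succ s hs ih =>
    refine lt_of_le_of_lt ?_ (ih (by omega))
    obtain ⟨r, rfl⟩ := Nat.exists_eq_add_of_lt hsk
    have h1 : 2 * (s + 1 + r + 1 - s) - 1 = 2 * r + 1 + 2 := by omega
    have h2 : 2 * (s + 1 + r + 1 - (s + 1)) - 1 = 2 * r + 1 := by omega
    have h3 : s + 1 - 2 = (s - 2) + 1 := by omega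
    have h4 : s + 1 + r + 1 - 2 - (s - 2) = r + 2 := by omega
    rw [h1, h2, h3, Nat.descFactorial_succ, h4, Nat.doubleFactorial]
    set A := (s + 1 + r + 1 - 2) * (s + 1 + r + 1 - 2).descFactorial (s - 2) * (2 * r + 1)‼
    have key : (s + 1) * (r + 2) ≤ s * (2 * r + 1 + 2) := by nlinarith
    calc _ = (s + 1) * (r + 2) * A := by simp only [A]; ring
      _ ≤ s * (2 * r + 1 + 2) * A := Nat.mul_le_mul_right _ key
      _ = _ := by simp only [A]; ring

theorem mul_mul_factorial_lt_doubleFactorial (n : ℕ) :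
    (n + 5) * ((n + 3) * (n + 3)!) < (2 * n + 7)‼ := by
  induction n with
  | zero => decide
  | succ n ih =>
    have h1 : 2 * (n + 1) + 7 = 2 * n + 7 + 2 := by ring
    rw [h1, Nat.doubleFactorial, show n + 1 + 3 = n + 3 + 1 by ring, Nat.factorial_succ]
    have hpos : 0 < (n + 5) * (n + 3) := by positivity
    refine lt_of_mul_lt_mul_left ?_ hpos.le
    calc (n + 5) * (n + 3) * ((n + 1 + 5) * ((n + 3 + 1) * ((n + 3 + 1) * (n + 3)!)))
        = (n + 6) * (n + 4) ^ 2 * ((n + 5) * ((n + 3) * (n + 3)!)) := by ring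
      _ ≤ (n + 5) * (n + 3) * (2 * n + 7 + 2) * ((n + 5) * ((n + 3) * (n + 3)!)) :=
          Nat.mul_le_mul_right _ (by nlinarith [sq_nonneg n, Nat.zero_le (n ^ 3)])
      _ < (n + 5) * (n + 3) * (2 * n + 7 + 2) * (2 * n + 7)‼ :=
          Nat.mul_lt_mul_of_pos_left ih (by positivity)
      _ = _ := by ring

/-- The extra units absorb the failure of the plain product bound for `k = 3` and `k = 4`. -/
theorem mul_sub_one_lt_doubleFactorial {k : ℕ} (hk : 3 ≤ k) :
    k * ((k - 2) * (k - 2)! - 1) + 1 < (2 * k - 3)‼ := by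
  rcases lt_or_ge k 5 with h | h
  · interval_cases k <;> decide
  · obtain ⟨n, rfl⟩ := Nat.exists_eq_add_of_le' h
    have key := mul_mul_factorial_lt_doubleFactorial n
    have h1 : n + 5 - 2 = n + 3 := by omega
    have h2 : 2 * (n + 5) - 3 = 2 * n + 7 := by omega
    rw [h1, h2]
    have hpos : 1 ≤ (n + 3) * (n + 3)! := Nat.mul_pos (by omega) (Nat.factorial_pos _)
    obtain ⟨c, hc⟩ := Nat.exists_eq_add_of_le' hpos
    rw [hc] at key ⊢
    rw [Nat.add_sub_cancel]
    nlinarith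

/-! ### Families without a common edge -/

section Pairings

variable {α : Type*} [Fintype α] [DecidableEq α]

theorem Covers.card_le_sum {C : Finset (Sym2 α)} {F : Finset (Perm α)} (hC : Covers C F) {b : ℕ}
    (hb : ∀ e, #(link F {e}) ≤ b) : #F ≤ #C * b := by
  have hsub : F ⊆ C.biUnion fun e => link F {e} := by
    intro f hf
    obtain ⟨e, he, hef⟩ := not_disjoint_iff.1 (hC f hf)
    exact mem_biUnion.2 ⟨e, he, mem_link.2 ⟨hf, singleton_subset_iff.2 hef⟩⟩
  calc #F ≤ ∑ e ∈ C, #(link F {e}) := (card_le_card hsub).trans card_biUnion_le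
    _ ≤ ∑ _e ∈ C, b := sum_le_sum fun e _ => hb e
    _ = #C * b := by rw [sum_const, smul_eq_mul]

/-- The member `f` lies in the link of each of its own edges, so removing it first saves one in
every summand. -/
theorem card_le_of_mem {F : Finset (Perm α)} {f : Perm α} (hf : f ∈ F)
    (hint : ∀ g ∈ F, (pairs g ∩ pairs f).Nonempty) {b : ℕ} (hb : ∀ e, #(link F {e}) ≤ b) :
    #F ≤ #(pairs f) * (b - 1) + 1 := by
  have hsub : F.erase f ⊆ (pairs f).biUnion fun e => (link F {e}).erase f := by
    intro g hg
    obtain ⟨hgf, hg⟩ := mem_erase.1 hg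
    obtain ⟨e, he⟩ := hint g hg
    rw [mem_inter] at he
    exact mem_biUnion.2 ⟨e, he.2,
      mem_erase.2 ⟨hgf, mem_link.2 ⟨hg, singleton_subset_iff.2 he.1⟩⟩⟩
  rw [← card_erase_add_one hf]
  gcongr
  calc #(F.erase f) ≤ ∑ e ∈ pairs f, #((link F {e}).erase f) :=
        (card_le_card hsub).trans card_biUnion_le
    _ ≤ ∑ _e ∈ pairs f, (b - 1) := sum_le_sum fun e he => by
        rw [card_erase_of_mem (mem_link.2 ⟨hf, singleton_subset_iff.2 he⟩)]
        exact Nat.sub_le_sub_right (hb e) 1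
    _ = #(pairs f) * (b - 1) := by rw [sum_const, smul_eq_mul]

/-- An intersecting family of pairings without a common edge is smaller than a star. -/
theorem card_lt_of_not_covers_singleton {F : Finset (Perm α)} (hF : ∀ f ∈ F, IsPairing f)
    (hint : ∀ f ∈ F, ∀ g ∈ F, (pairs f ∩ pairs g).Nonempty) {k : ℕ}
    (hk : Fintype.card α = 2 * k) (hcov : ∀ C : Finset (Sym2 α), #C ≤ 1 → ¬ Covers C F) :
    #F < (2 * k - 3)‼ := by
  classical
  rcases F.eq_empty_or_nonempty with rfl | ⟨f, hf⟩
  · simpa using Nat.doubleFactorial_pos _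
  have hfC : Covers (pairs f) F := fun g hg => by
    rw [disjoint_iff_inter_eq_empty, ← ne_eq, ← nonempty_iff_ne_empty]
    exact hint f hf g hg
  have hfk : #(pairs f) = k := by have := (hF f hf).two_mul_card_pairs; omega
  have hex : ∃ s, ∃ C : Finset (Sym2 α), #C = s ∧ Covers C F := ⟨_, pairs f, rfl, hfC⟩
  obtain ⟨C, hCs, hC⟩ := Nat.find_spec hex
  have hmin : ∀ C : Finset (Sym2 α), #C < Nat.find hex → ¬ Covers C F :=
    fun C hC h => Nat.find_min hex hC ⟨C, rfl, h⟩
  have hsk : Nat.find hex ≤ k := Nat.find_min' hex ⟨pairs f, hfk, hfC⟩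
  have hs2 : 2 ≤ Nat.find hex := by
    by_contra h
    exact hcov C (by omega) hC
  set s := Nat.find hex
  have hlink := card_link_singleton_le hF hint hk hs2 hmin
  rcases hsk.lt_or_eq with hlt | heq
  · have := hC.card_le_sum hlink
    rw [hCs] at this
    exact this.trans_lt (mul_descFactorial_mul_doubleFactorial_lt hs2 hlt)
  · have h2 := hC.card_le_sum hlink
    have hFpos : 0 < #F := card_pos.2 ⟨f, hf⟩
    -- For `k = 2` the factor `k - 2` in the link bound would make `F` empty.
    have hk3 : 3 ≤ k := by
      by_contra h
      have : k = 2 := by omega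
      simp [this] at h2
      simp [h2] at hFpos
    have h3 := card_le_of_mem hf (fun g hg => hint g hg f hf) hlink
    rw [heq, hfk, Nat.descFactorial_self, Nat.sub_self] at h3
    simp only [mul_zero, Nat.zero_sub, Nat.doubleFactorial, mul_one] at h3
    exact h3.trans_lt (mul_sub_one_lt_doubleFactorial hk3)

end Pairings

/-! ### Transfer to perfect matchings as subgraphs -/

section PerfectMatchings

variable {k : ℕ}

theorem PM.existsUnique_adj (M : PM k) (x : Fin (2 * k)) : ∃! y, M.1.Adj x y :=
  SimpleGraph.Subgraph.isPerfectMatching_iff.1 M.2 x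

/-- The pairing that interchanges the ends of every edge of a perfect matching. -/
noncomputable def PM.toPerm (M : PM k) : Perm (Fin (2 * k)) :=
  Function.Involutive.toPerm (fun x => (M.existsUnique_adj x).choose) fun x =>
    (M.existsUnique_adj _).unique (M.existsUnique_adj _).choose_spec.1
      (M.existsUnique_adj x).choose_spec.1.symm

theorem PM.adj_toPerm (M : PM k) (x : Fin (2 * k)) : M.1.Adj x (M.toPerm x) :=
  (M.existsUnique_adj x).choose_spec.1

theorem PM.toPerm_apply_eq_iff {M : PM k} {x y : Fin (2 * k)} :
    M.toPerm x = y ↔ M.1.Adj x y :=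
  ⟨fun h => h ▸ M.adj_toPerm x, fun h => (M.existsUnique_adj x).unique (M.adj_toPerm x) h⟩

theorem PM.isPairing_toPerm (M : PM k) : IsPairing M.toPerm := fun x =>
  ⟨(M.1.adj_sub (M.adj_toPerm x)).ne', toPerm_apply_eq_iff.2 (M.adj_toPerm x).symm⟩

theorem PM.mem_pairs_toPerm {M : PM k} {e : Sym2 (Fin (2 * k))} :
    e ∈ pairs M.toPerm ↔ e ∈ M.1.edgeSet := by
  induction e with
  | _ x y =>
    rw [M.isPairing_toPerm.mem_pairs, toPerm_apply_eq_iff, SimpleGraph.Subgraph.mem_edgeSet]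

theorem PM.toPerm_injective : Function.Injective (PM.toPerm (k := k)) := by
  intro M N h
  apply Subtype.ext
  ext x y
  · exact iff_of_true (M.2.2 x) (N.2.2 x)
  · rw [← toPerm_apply_eq_iff, h, toPerm_apply_eq_iff]

theorem IsPairing.exists_toPerm_eq {f : Perm (Fin (2 * k))} (hf : IsPairing f) :
    ∃ M : PM k, M.toPerm = f := by
  let M : (⊤ : SimpleGraph (Fin (2 * k))).Subgraph :=
    { verts := Set.univ
      Adj := fun x y => f x = y
      adj_sub := fun {x y} h => by
        subst h
        exact (hf x).1.symm
      edge_vert := fun _ => Set.mem_univ _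
      symm := ⟨fun x y h => by
        subst h
        exact (hf x).2⟩ }
  have hM : M.IsPerfectMatching :=
    SimpleGraph.Subgraph.isPerfectMatching_iff.2 fun x => ⟨f x, rfl, fun _ h => Eq.symm h⟩
  exact ⟨⟨M, hM⟩, Equiv.ext fun x => PM.toPerm_apply_eq_iff.2 rfl⟩

/-- A starting point for `IsPairing.exists_apply_eq`, which turns it into a pairing with any
prescribed edge. -/
theorem isPairing_revPerm : IsPairing (Fin.revPerm : Perm (Fin (2 * k))) := by
  refine fun x => ⟨fun h => ?_, Fin.rev_rev x⟩
  have := congrArg Fin.val h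
  rw [Fin.revPerm_apply, Fin.val_rev] at this
  omega

theorem ncard_canonical {e : Sym2 (Fin (2 * k))}
    (he : e ∈ (⊤ : SimpleGraph (Fin (2 * k))).edgeSet) :
    (canonical (k := k) e).ncard = (2 * k - 3)‼ := by
  obtain ⟨f, hf, hef⟩ : ∃ f : Perm (Fin (2 * k)), IsPairing f ∧ e ∈ pairs f := by
    induction e with
    | _ a b =>
      have hba : b ≠ a := Ne.symm (by simpa using he)
      obtain ⟨f, hf, hfa, -⟩ := isPairing_revPerm.exists_apply_eq hba
      exact ⟨f, hf, hf.mem_pairs.2 hfa⟩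
  have hcard := hf.card_superset (Fintype.card_fin _) (singleton_subset_iff.2 hef)
  rw [card_singleton, show 2 * (k - 1) - 1 = 2 * k - 3 by omega] at hcard
  rw [← hcard, ← Set.ncard_image_of_injective _ PM.toPerm_injective, ← Set.ncard_coe_finset]
  congr 1
  ext g
  simp only [canonical, Set.mem_image, Set.mem_ofPred_eq, coe_filter, mem_univ, true_and,
    singleton_subset_iff]
  constructor
  · rintro ⟨M, hM, rfl⟩
    exact ⟨M.isPairing_toPerm, PM.mem_pairs_toPerm.2 hM⟩
  · rintro ⟨hg, heg⟩
    obtain ⟨M, rfl⟩ := hg.exists_toPerm_eq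
    exact ⟨M, PM.mem_pairs_toPerm.1 heg, rfl⟩

theorem isIntersecting_canonical (e : Sym2 (Fin (2 * k))) :
    IsIntersecting (canonical (k := k) e) :=
  fun _ hM _ hN _ => ⟨e, hM, hN⟩

/-- An intersecting family is contained in some `canonical e` or is smaller than it. -/
theorem IsIntersecting.ncard_lt_or_subset_canonical (hk : 1 ≤ k) {F : Set (PM k)}
    (hF : IsIntersecting F) :
    F.ncard < (2 * k - 3)‼ ∨
      ∃ e ∈ (⊤ : SimpleGraph (Fin (2 * k))).edgeSet, F ⊆ canonical e := by
  classical
  rcases F.eq_empty_or_nonempty with rfl | ⟨M₀, hM₀⟩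
  · exact Or.inl (by simpa using Nat.doubleFactorial_pos _)
  set G : Finset (Perm (Fin (2 * k))) := F.toFinite.toFinset.image PM.toPerm with hG
  have hmem : ∀ f, f ∈ G ↔ ∃ M ∈ F, PM.toPerm M = f := fun f => by simp [hG]
  have hcard : #G = F.ncard := by
    rw [hG, card_image_of_injective _ PM.toPerm_injective, ← Set.ncard_eq_toFinset_card]
  have hpair : ∀ f ∈ G, IsPairing f := by
    intro f hf
    obtain ⟨M, -, rfl⟩ := (hmem f).1 hf
    exact M.isPairing_toPerm
  have hint : ∀ f ∈ G, ∀ g ∈ G, (pairs f ∩ pairs g).Nonempty := by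
    intro f hf g hg
    obtain ⟨M, hM, rfl⟩ := (hmem f).1 hf
    obtain ⟨N, hN, rfl⟩ := (hmem g).1 hg
    -- `IsIntersecting` only concerns distinct members; a matching meets itself because `1 ≤ k`
    -- provides an edge.
    rcases eq_or_ne M N with rfl | hMN
    · rw [inter_self]
      exact ⟨_, mem_image_of_mem _ (mem_univ ⟨0, by omega⟩)⟩
    · obtain ⟨e, heM, heN⟩ := hF hM hN hMN
      exact ⟨e, mem_inter.2 ⟨PM.mem_pairs_toPerm.2 heM, PM.mem_pairs_toPerm.2 heN⟩⟩
  by_cases hcov : ∀ C : Finset (Sym2 (Fin (2 * k))), #C ≤ 1 → ¬ Covers C G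
  · left
    rw [← hcard]
    exact card_lt_of_not_covers_singleton hpair hint (Fintype.card_fin _) hcov
  · right
    push Not at hcov
    obtain ⟨C, hC1, hC⟩ := hcov
    obtain ⟨e, heC, heM⟩ := not_disjoint_iff.1 (hC _ ((hmem _).2 ⟨M₀, hM₀, rfl⟩))
    refine ⟨e, M₀.1.edgeSet_subset (PM.mem_pairs_toPerm.1 heM), fun M hM => ?_⟩
    obtain ⟨e', heC', heM'⟩ := not_disjoint_iff.1 (hC _ ((hmem _).2 ⟨M, hM, rfl⟩))
    rw [card_le_one.1 hC1 _ heC' _ heC] at heM'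
    exact PM.mem_pairs_toPerm.1 heM'

theorem IsIntersecting.ncard_le (hk : 1 ≤ k) {F : Set (PM k)} (hF : IsIntersecting F) :
    F.ncard ≤ (2 * k - 3)‼ := by
  rcases hF.ncard_lt_or_subset_canonical hk with h | ⟨e, he, h⟩
  · exact h.le
  · rw [← ncard_canonical he]
    exact Set.ncard_le_ncard h (Set.toFinite _)

theorem isIntersecting_and_ncard_eq_iff (hk : 1 ≤ k) {F : Set (PM k)} :
    (IsIntersecting F ∧ F.ncard = (2 * k - 3)‼) ↔
      ∃ e ∈ (⊤ : SimpleGraph (Fin (2 * k))).edgeSet, F = canonical e := by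
  constructor
  · rintro ⟨hF, hc⟩
    rcases hF.ncard_lt_or_subset_canonical hk with h | ⟨e, he, h⟩
    · exact absurd hc h.ne
    · exact ⟨e, he, Set.eq_of_subset_of_ncard_le h (by rw [ncard_canonical he, hc])
        (Set.toFinite _)⟩
  · rintro ⟨e, he, rfl⟩
    exact ⟨isIntersecting_canonical e, ncard_canonical he⟩

/-! ### Cocliques of the derangement graph -/

theorem isIndepSet_derangementGraph_iff {F : Set (PM k)} :
    (derangementGraph k).IsIndepSet F ↔ IsIntersecting F := by
  simp only [SimpleGraph.isIndepSet_iff, IsIntersecting, Set.Pairwise]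
  refine forall₅_congr fun M _ N _ hMN => ?_
  simp [derangementGraph, hMN]

theorem exists_isIndepSet_card_eq (hk : 1 ≤ k) :
    ∃ F : Finset (PM k), (derangementGraph k).IsIndepSet (F : Set (PM k)) ∧
      #F = (2 * k - 3)‼ := by
  let e : Sym2 (Fin (2 * k)) := s(⟨0, by omega⟩, ⟨1, by omega⟩)
  have he : e ∈ (⊤ : SimpleGraph (Fin (2 * k))).edgeSet := by simp [e]
  refine ⟨(Set.toFinite (canonical e)).toFinset, ?_, ?_⟩
  · rw [isIndepSet_derangementGraph_iff, Set.Finite.coe_toFinset]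
    exact isIntersecting_canonical e
  · rw [← Set.ncard_eq_toFinset_card, ncard_canonical he]

theorem isMaximumIndepSet_iff_card_eq (hk : 1 ≤ k) {F : Finset (PM k)} :
    (derangementGraph k).IsMaximumIndepSet F ↔
      IsIntersecting (F : Set (PM k)) ∧ (F : Set (PM k)).ncard = (2 * k - 3)‼ := by
  rw [SimpleGraph.isMaximumIndepSet_iff, isIndepSet_derangementGraph_iff]
  refine and_congr_right fun hF => ?_
  rw [Set.ncard_coe_finset]
  have hle : ∀ G : Finset (PM k), (derangementGraph k).IsIndepSet (G : Set (PM k)) →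
      #G ≤ (2 * k - 3)‼ := fun G hG => by
    rw [← Set.ncard_coe_finset]
    exact (isIndepSet_derangementGraph_iff.1 hG).ncard_le hk
  constructor
  · intro h
    obtain ⟨G, hG, hGc⟩ := exists_isIndepSet_card_eq hk
    exact le_antisymm (hle F (isIndepSet_derangementGraph_iff.2 hF)) (hGc ▸ h G hG)
  · intro h G hG
    rw [h]
    exact hle G hG

theorem indepNum_derangementGraph (hk : 1 ≤ k) :
    (derangementGraph k).indepNum = (2 * k - 3)‼ := by
  obtain ⟨F, hF⟩ := (derangementGraph k).maximumIndepSet_exists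
  rw [← (derangementGraph k).maximumIndepSet_card_eq_indepNum F hF, ← Set.ncard_coe_finset]
  exact ((isMaximumIndepSet_iff_card_eq hk).1 hF).2

end PerfectMatchings

end MatchingEKR

theorem mainTheorem1 (k : ℕ) (hk : 1 ≤ k) :
    -- the bound; for `k = 1` the expression `(2 * k - 3)‼` is `0‼ = 1 = (-1)‼`
    (∀ F : Set (MatchingEKR.PM k), MatchingEKR.IsIntersecting F → F.ncard ≤ (2 * k - 3)‼) ∧
    -- equality holds exactly for the canonically intersecting families
    (∀ F : Set (MatchingEKR.PM k),
      (MatchingEKR.IsIntersecting F ∧ F.ncard = (2 * k - 3)‼) ↔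
        ∃ e ∈ (⊤ : SimpleGraph (Fin (2 * k))).edgeSet, F = MatchingEKR.canonical e) ∧
    -- the same in terms of cocliques of the derangement graph
    (MatchingEKR.derangementGraph k).indepNum = (2 * k - 3)‼ ∧
    (∀ F : Finset (MatchingEKR.PM k),
      (MatchingEKR.derangementGraph k).IsMaximumIndepSet F ↔
        ∃ e ∈ (⊤ : SimpleGraph (Fin (2 * k))).edgeSet,
          (F : Set (MatchingEKR.PM k)) = MatchingEKR.canonical e) := by
  exact ⟨fun _ hF => hF.ncard_le hk,
    fun _ => MatchingEKR.isIntersecting_and_ncard_eq_iff hk,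
    MatchingEKR.indepNum_derangementGraph hk,
    fun _ => (MatchingEKR.isMaximumIndepSet_iff_card_eq hk).trans
      (MatchingEKR.isIntersecting_and_ncard_eq_iff hk)⟩
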